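/- Let $E_0,A_0\in\mathbb C^{n,n}$ be such that the pencil $\lambda E_0-A_0$ is regular, i.e. $\det(\lambda E_0-A_0)$ does not vanish identically in $\lambda$. Its finite eigenvalues are the zeros of $\det(\lambda E_0-A_0)$. Its Kronecker (Weierstrass) canonical form is the direct sum, unique up to order, of blocks $\lambda I_k-J_k(\lambda_0)$ (size $k\ge 1$, at the finite eigenvalue $\lambda_0$) and $\lambda J_k(0)-I_k$ (size $k\ge 1$, at infinity) to which $\lambda E_0-A_0$ is transformed by $\lambda E_0-A_0\mapsto S(\lambda E_0-A_0)T$ with some invertible $S,T\in\mathbb C^{n,n}$; here $J_k(\lambda_0)$ is the $k\times k$ Jordan block with eigenvalue $\lambda_0$. Consider the form $$\lambda E-(J-R)Q,\qquad E,J,R,Q\in\mathbb C^{n,n},\quad J^*=-J,\quad R\ge 0,\quad Q^*E\ge 0, \tag{$*$}$$ where $X\geq 0$ ($X>0$) means that $X$ is Hermitian positive semidefinite (positive definite). **Theorem.** (i) $\lambda E_0-A_0$ is of the form $(*)$ with $Q$ invertible if and only if all its finite eigenvalues lie in the closed left half-plane $\{\operatorname{Re} z\le 0\}$, all its Kronecker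 blocks at finite eigenvalues on the imaginary axis have size one, and all its Kronecker blocks at infinity have size at most two. (ii) $\lambda E_0-A_0$ is of the form $(*)$ with $Q>0$ if and only if there are an invertible $T\in\mathbb C^{n,n}$ and a pencil $\lambda E-(J-R)$ of the form $(*)$ with $Q=I_n$ (that is, $E\ge0$, $R\geq 0$, $J^*=-J$) such that $$\lambda E_0-A_0=T^{-1}\bigl(\lambda E-(J-R)\bigr)T .$$ In particular, in this case $E_0$ is diagonalizable with (real) nonnegative eigenvalues. -/

import Mathlib

open scoped ComplexOrder

/-- The square pencil `λ E - A` is regular: `det (λ E - A)` does not vanish identically. -/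
def PencilRegular {n : ℕ} (E A : Matrix (Fin n) (Fin n) ℂ) : Prop :=
  ∃ z : ℂ, (z • E - A).det ≠ 0

/-- `z` is a (finite) eigenvalue of the regular pencil `λ E - A`. -/
def PencilEigenvalue {n : ℕ} (E A : Matrix (Fin n) (Fin n) ℂ) (z : ℂ) : Prop :=
  (z • E - A).det = 0

/-- The upper triangular Jordan block of size `k` with eigenvalue `z`. -/
def jordanBlock (z : ℂ) (k : ℕ) : Matrix (Fin k) (Fin k) ℂ :=
  Matrix.of fun i j => if i = j then z else if (i : ℕ) + 1 = (j : ℕ) then 1 else 0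

/-- The blocks that occur in the Kronecker canonical form of a regular pencil:
`finite z k` is `λ I - J_k(z)`, the block of size `k` at the point `z` of the plane;
`infinite k` is `λ J_k(0) - I`, the block of size `k` at infinity. -/
inductive KroneckerBlock : Type
  | finite (z : ℂ) (k : ℕ)
  | infinite (k : ℕ)

namespace KroneckerBlock

/-- The size of a block. -/
def size : KroneckerBlock → ℕ
  | finite _ k => k
  | infinite k => k

/-- The coefficient of `λ` in a block `λ E - A`. -/
def matE : (b : KroneckerBlock) → Matrix (Fin b.size) (Fin b.size) ℂ
  | finite _ k => (1 : Matrix (Fin k) (Fin k) ℂ)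
  | infinite k => jordanBlock 0 k

/-- The matrix `A` in a block `λ E - A`. -/
def matA : (b : KroneckerBlock) → Matrix (Fin b.size) (Fin b.size) ℂ
  | finite z k => jordanBlock z k
  | infinite k => (1 : Matrix (Fin k) (Fin k) ℂ)

end KroneckerBlock

/-- The direct sum of the blocks `b 0, …, b (m - 1)`, all of positive size, is a Kronecker
canonical form of the regular pencil `λ E - A`: there are invertible `S`, `T` such that
`S (λ E - A) T` is this direct sum. The bijection `e` is only the
enumeration of the rows and columns of the block diagonal matrix. -/
def IsKroneckerForm {n m : ℕ} (E A : Matrix (Fin n) (Fin n) ℂ)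
    (b : Fin m → KroneckerBlock) : Prop :=
  (∀ i, 0 < (b i).size) ∧
  ∃ (e : (Σ i : Fin m, Fin (b i).size) ≃ Fin n) (S T : Matrix (Fin n) (Fin n) ℂ),
    IsUnit S ∧ IsUnit T ∧
    S * E * T = Matrix.reindex e e (Matrix.blockDiagonal' fun i => (b i).matE) ∧
    S * A * T = Matrix.reindex e e (Matrix.blockDiagonal' fun i => (b i).matA)

/-- The block `c` occurs in the Kronecker canonical form of the regular pencil `λ E - A`
(this form is unique up to the order of the blocks). -/
def HasKroneckerBlock {n : ℕ} (E A : Matrix (Fin n) (Fin n) ℂ) (c : KroneckerBlock) : Prop :=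
  ∃ (m : ℕ) (b : Fin m → KroneckerBlock), IsKroneckerForm E A b ∧ ∃ i, b i = c

/-- The pencil `λ E - A` is of the form `λ E - (J - R) Q` with `J` skew-Hermitian, `R ≥ 0`,
`Q* E ≥ 0` and `Q` as specified by `P`. -/
def IsDHForm {n : ℕ} (P : Matrix (Fin n) (Fin n) ℂ → Prop)
    (E A : Matrix (Fin n) (Fin n) ℂ) : Prop :=
  ∃ J R Q : Matrix (Fin n) (Fin n) ℂ,
    J.conjTranspose = -J ∧ R.PosSemidef ∧ (Q.conjTranspose * E).PosSemidef ∧ P Q ∧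
    A = (J - R) * Q

/-! Multiplying `λE - (J - R)Q` on the left by `Qᴴ` gives `λ QᴴE - Qᴴ(J - R)Q`. So the form with `Q`
invertible exists exactly when some invertible `S` makes `S E ≥ 0` and `S A` dissipative, meaning `S
A + (S A)ᴴ ≤ 0`. A congruence turns a two-sided equivalence `S(λE - A)T` into such a one-sided one.
The property is therefore an invariant of pencil equivalence and may be checked block by block.

Necessity: an eigenvector satisfies `Re z · v*Ev = -v*Rv`, and regularity forces `v*Ev > 0`, so `Re
z ≤ 0`. If a chain on the imaginary axis has length two, or one at infinity has length three, then
`R` kills its first vector. Pairing the chain relations with that vector then contradicts regularity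
(`no_imaginary_chain_of_length_two`, `no_infinite_chain_of_length_three`).

Sufficiency: the pencil is reduced to its Weierstrass form, and each admissible block is made
dissipative by an explicit scaling, sign change or rotation. The canonical form comes from the
`ℂ[X]`-module structure defined by `G⁻¹E`, where `G = z₀E - A` is invertible.

For `Q > 0`, factor `Q = BᴴB`; similarity by `B` then turns `Q` into the identity. -/

open Matrix

/-! ### Dissipative pencils under equivalence and direct sums -/

section Symmetric

/-- Every matrix with `A + Aᴴ ≤ 0` splits into a skew-Hermitian and a dissipative part. -/
theorem exists_skew_sub_posSemidef {ι : Type*} {A : Matrix ι ι ℂ} (hA : (-(A + Aᴴ)).PosSemidef) :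
    ∃ J R : Matrix ι ι ℂ, Jᴴ = -J ∧ R.PosSemidef ∧ A = J - R := by
  have h2 : (0 : ℂ) ≤ 1 / 2 := by positivity
  refine ⟨(1 / 2 : ℂ) • (A - Aᴴ), (1 / 2 : ℂ) • (-(A + Aᴴ)), ?_, hA.smul h2, ?_⟩
  · rw [conjTranspose_smul, conjTranspose_sub, conjTranspose_conjTranspose, ← smul_neg, neg_sub]
    simp
  · rw [← smul_sub, sub_neg_eq_add, sub_add_add_cancel, ← two_smul ℂ A, smul_smul]
    norm_num

theorem conjTranspose_mul_mul_skew {ι : Type*} [Fintype ι] {J : Matrix ι ι ℂ} (hJ : Jᴴ = -J) (B : Matrix ι ι ℂ) :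
    (Bᴴ * J * B)ᴴ = -(Bᴴ * J * B) := by
  simp [conjTranspose_mul, hJ, Matrix.mul_assoc]

variable {ι κ : Type*} [Fintype ι] [DecidableEq ι] [Fintype κ] [DecidableEq κ]

/-- The pencil `λ E - A` is equivalent to one with `E ≥ 0` and `A + Aᴴ ≤ 0`. -/
def IsEquivDissipative (E A : Matrix ι ι ℂ) : Prop :=
  ∃ S T : Matrix ι ι ℂ, IsUnit S ∧ IsUnit T ∧ (S * E * T).PosSemidef ∧
    (-(S * A * T + (S * A * T)ᴴ)).PosSemidef

/-- Congruence by `T⁻¹` cancels `T` on the right and preserves both semidefiniteness conditions. -/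
theorem IsEquivDissipative.exists_left {E A : Matrix ι ι ℂ} (h : IsEquivDissipative E A) :
    ∃ S : Matrix ι ι ℂ, IsUnit S ∧ (S * E).PosSemidef ∧ (-(S * A + (S * A)ᴴ)).PosSemidef := by
  obtain ⟨S, T, hS, hT, hE, hA⟩ := h
  have hTT : T * T⁻¹ = 1 := mul_nonsing_inv T ((isUnit_iff_isUnit_det T).1 hT)
  have hTi : IsUnit T⁻¹ := (Matrix.isUnit_nonsing_inv_iff).2 hT
  refine ⟨(T⁻¹)ᴴ * S, ((isUnit_conjTranspose _).2 hTi).mul hS, ?_, ?_⟩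
  · have := hE.conjTranspose_mul_mul_same T⁻¹
    rwa [Matrix.mul_assoc, Matrix.mul_assoc (S * E), hTT, Matrix.mul_one, ← Matrix.mul_assoc] at this
  · have := hA.conjTranspose_mul_mul_same T⁻¹
    have e : (T⁻¹)ᴴ * (S * A * T) * T⁻¹ = (T⁻¹)ᴴ * S * A := by
      rw [Matrix.mul_assoc, Matrix.mul_assoc (S * A), hTT, Matrix.mul_one, ← Matrix.mul_assoc]
    have e' : (T⁻¹)ᴴ * (S * A * T)ᴴ * T⁻¹ = ((T⁻¹)ᴴ * S * A)ᴴ := by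
      rw [← e]; simp [conjTranspose_mul, Matrix.mul_assoc]
    rwa [Matrix.mul_neg, Matrix.neg_mul, Matrix.mul_add, Matrix.add_mul, e, e'] at this

theorem IsEquivDissipative.of_equiv {E A S T : Matrix ι ι ℂ} (hS : IsUnit S) (hT : IsUnit T)
    (h : IsEquivDissipative (S * E * T) (S * A * T)) : IsEquivDissipative E A := by
  obtain ⟨S', T', hS', hT', hE, hA⟩ := h
  refine ⟨S' * S, T * T', hS'.mul hS, hT.mul hT', ?_, ?_⟩
  · simpa only [Matrix.mul_assoc] using hE
  · simpa only [Matrix.mul_assoc] using hA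

theorem IsEquivDissipative.reindex {E A : Matrix ι ι ℂ} (h : IsEquivDissipative E A)
    (e : ι ≃ κ) : IsEquivDissipative (Matrix.reindex e e E) (Matrix.reindex e e A) := by
  obtain ⟨S, T, hS, hT, hE, hA⟩ := h
  refine ⟨S.submatrix e.symm e.symm, T.submatrix e.symm e.symm, ?_, ?_, ?_, ?_⟩
  · exact (isUnit_submatrix_equiv e.symm e.symm).2 hS
  · exact (isUnit_submatrix_equiv e.symm e.symm).2 hT
  · simpa [submatrix_mul_equiv] using hE.submatrix e.symm
  · have h := hA.submatrix e.symm
    rw [submatrix_neg, submatrix_add] at h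
    simpa [submatrix_mul_equiv] using h

open scoped MatrixOrder in
theorem Matrix.PosSemidef.exists_eq_conjTranspose_mul_self {M : Matrix ι ι ℂ}
    (hM : M.PosSemidef) : ∃ B : Matrix ι ι ℂ, M = Bᴴ * B :=
  CStarAlgebra.nonneg_iff_eq_star_mul_self.1 hM.nonneg

theorem posSemidef_blockDiagonal' {m : Type*} [Fintype m] [DecidableEq m] {s : m → Type*}
    [∀ i, Fintype (s i)] [∀ i, DecidableEq (s i)] {M : ∀ i, Matrix (s i) (s i) ℂ}
    (h : ∀ i, (M i).PosSemidef) : (blockDiagonal' M).PosSemidef := by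
  choose B hB using fun i => (h i).exists_eq_conjTranspose_mul_self
  have : blockDiagonal' M = (blockDiagonal' B)ᴴ * blockDiagonal' B := by
    rw [blockDiagonal'_conjTranspose, ← blockDiagonal'_mul]
    congr 1; funext i; exact hB i
  rw [this]
  exact posSemidef_conjTranspose_mul_self _

theorem isUnit_blockDiagonal' {m : Type*} [Fintype m] [DecidableEq m] {s : m → Type*}
    [∀ i, Fintype (s i)] [∀ i, DecidableEq (s i)] {M : ∀ i, Matrix (s i) (s i) ℂ}
    (h : ∀ i, IsUnit (M i)) : IsUnit (blockDiagonal' M) := by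
  refine IsUnit.of_mul_eq_one (Matrix.blockDiagonal' fun i => (M i)⁻¹) ?_
  rw [← blockDiagonal'_mul, ← blockDiagonal'_one]
  congr 1; funext i
  exact mul_nonsing_inv _ ((isUnit_iff_isUnit_det _).1 (h i))

theorem IsEquivDissipative.blockDiagonal' {m : Type*} [Fintype m] [DecidableEq m] {s : m → Type*}
    [∀ i, Fintype (s i)] [∀ i, DecidableEq (s i)] {E A : ∀ i, Matrix (s i) (s i) ℂ}
    (h : ∀ i, IsEquivDissipative (E i) (A i)) :
    IsEquivDissipative (Matrix.blockDiagonal' E) (Matrix.blockDiagonal' A) := by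
  choose S T hS hT hE hA using h
  refine ⟨Matrix.blockDiagonal' S, Matrix.blockDiagonal' T, isUnit_blockDiagonal' hS,
    isUnit_blockDiagonal' hT, ?_, ?_⟩
  · rw [← blockDiagonal'_mul, ← blockDiagonal'_mul]
    exact posSemidef_blockDiagonal' hE
  · rw [← blockDiagonal'_mul, ← blockDiagonal'_mul, blockDiagonal'_conjTranspose,
      ← blockDiagonal'_add, ← blockDiagonal'_neg]
    exact posSemidef_blockDiagonal' hA

end Symmetric

/-! ### Reformulations for invertible and for positive definite `Q` -/

section DHForm

variable {n : ℕ} {E A : Matrix (Fin n) (Fin n) ℂ}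

theorem IsDHForm.exists_left (h : IsDHForm (fun Q => IsUnit Q) E A) :
    ∃ S J R : Matrix (Fin n) (Fin n) ℂ, IsUnit S ∧ (S * E).PosSemidef ∧ Jᴴ = -J ∧
      R.PosSemidef ∧ S * A = J - R := by
  obtain ⟨J, R, Q, hJ, hR, hE, hQ, rfl⟩ := h
  refine ⟨Qᴴ, Qᴴ * J * Q, Qᴴ * R * Q, (isUnit_conjTranspose _).2 hQ, hE,
    conjTranspose_mul_mul_skew hJ Q, hR.conjTranspose_mul_mul_same Q, ?_⟩
  rw [Matrix.sub_mul, Matrix.mul_sub, Matrix.mul_assoc, Matrix.mul_assoc]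

/-- Take `Q = Sᴴ`: if `S A = J - R`, then `A = S⁻¹(J - R)(S⁻¹)ᴴ · Sᴴ`, and congruence keeps `J` skew
and `R ≥ 0`. -/
theorem isDHForm_of_exists_left (h : ∃ S : Matrix (Fin n) (Fin n) ℂ, IsUnit S ∧
    (S * E).PosSemidef ∧ (-(S * A + (S * A)ᴴ)).PosSemidef) :
    IsDHForm (fun Q => IsUnit Q) E A := by
  obtain ⟨S, hS, hE, hA⟩ := h
  obtain ⟨J, R, hJ, hR, hJR⟩ := exists_skew_sub_posSemidef hA
  have hdet := (isUnit_iff_isUnit_det S).1 hS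
  have hinv : (S⁻¹)ᴴ * Sᴴ = 1 := by
    rw [← conjTranspose_mul, mul_nonsing_inv S hdet, conjTranspose_one]
  refine ⟨S⁻¹ * J * (S⁻¹)ᴴ, S⁻¹ * R * (S⁻¹)ᴴ, Sᴴ, ?_, hR.mul_mul_conjTranspose_same _,
    by rwa [conjTranspose_conjTranspose], (isUnit_conjTranspose _).2 hS, ?_⟩
  · simpa using conjTranspose_mul_mul_skew hJ (S⁻¹)ᴴ
  · rw [← Matrix.sub_mul, ← Matrix.mul_sub, ← hJR, Matrix.mul_assoc, hinv, Matrix.mul_one,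
      ← Matrix.mul_assoc, nonsing_inv_mul S hdet, Matrix.one_mul]

theorem isDHForm_posDef_iff :
    IsDHForm (fun Q => Q.PosDef) E A ↔
      ∃ T E' A' : Matrix (Fin n) (Fin n) ℂ, IsUnit T ∧ IsDHForm (fun Q => Q = 1) E' A' ∧
        E = T⁻¹ * E' * T ∧ A = T⁻¹ * A' * T := by
  constructor
  · rintro ⟨J, R, Q, hJ, hR, hE, hQ, rfl⟩
    obtain ⟨B, hB⟩ := hQ.posSemidef.exists_eq_conjTranspose_mul_self
    have hBu : IsUnit B := by
      rw [isUnit_iff_isUnit_det]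
      have h := (isUnit_iff_isUnit_det _).1 hQ.isUnit
      rw [hB, det_mul] at h
      exact isUnit_of_mul_isUnit_right h
    have hdet := (isUnit_iff_isUnit_det B).1 hBu
    have hBi : B⁻¹ * B = 1 := nonsing_inv_mul B hdet
    have hBi' : B * B⁻¹ = 1 := mul_nonsing_inv B hdet
    refine ⟨B, B * E * B⁻¹, B * (J - R) * Bᴴ, hBu,
      ⟨B * J * Bᴴ, B * R * Bᴴ, 1, ?_, hR.mul_mul_conjTranspose_same _, ?_, rfl, ?_⟩, ?_, ?_⟩
    · simpa using conjTranspose_mul_mul_skew hJ Bᴴ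
    · have h := hE.conjTranspose_mul_mul_same B⁻¹
      have hc : (B⁻¹)ᴴ * Bᴴ = 1 := by rw [← conjTranspose_mul, hBi', conjTranspose_one]
      rw [hQ.1.eq, hB, Matrix.mul_assoc Bᴴ, ← Matrix.mul_assoc (B⁻¹)ᴴ, hc, Matrix.one_mul] at h
      simpa using h
    · simp [Matrix.mul_sub, Matrix.sub_mul]
    · rw [Matrix.mul_assoc, Matrix.mul_assoc, hBi, Matrix.mul_one, ← Matrix.mul_assoc, hBi,
        Matrix.one_mul]
    · rw [hB, ← Matrix.mul_assoc, ← Matrix.mul_assoc B⁻¹, ← Matrix.mul_assoc B⁻¹, hBi,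
        Matrix.one_mul, Matrix.mul_assoc]
  · rintro ⟨T, E', A', hT, ⟨J, R, Q, hJ, hR, hE, rfl, rfl⟩, rfl, rfl⟩
    have hdet := (isUnit_iff_isUnit_det T).1 hT
    have hTi : T * T⁻¹ = 1 := mul_nonsing_inv T hdet
    have hc : (T⁻¹)ᴴ * Tᴴ = 1 := by rw [← conjTranspose_mul, hTi, conjTranspose_one]
    -- With `Q = TᴴT`, the factor `(T⁻¹)ᴴ` cancels the `Tᴴ` in `Q`, and `QᴴE` becomes the congruence
    -- `TᴴE'T`.
    refine ⟨T⁻¹ * J * (T⁻¹)ᴴ, T⁻¹ * R * (T⁻¹)ᴴ, Tᴴ * T, ?_, hR.mul_mul_conjTranspose_same _,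
      ?_, ?_, ?_⟩
    · simpa using conjTranspose_mul_mul_skew hJ (T⁻¹)ᴴ
    · have h := hE.conjTranspose_mul_mul_same T
      have e : (Tᴴ * T)ᴴ * (T⁻¹ * E' * T) = Tᴴ * (1ᴴ * E') * T := by
        rw [conjTranspose_mul, conjTranspose_conjTranspose, conjTranspose_one, Matrix.one_mul,
          Matrix.mul_assoc, Matrix.mul_assoc T⁻¹, ← Matrix.mul_assoc T, hTi, Matrix.one_mul,
          Matrix.mul_assoc]
      rwa [e]
    · refine PosDef.conjTranspose_mul_self T ?_
      exact mulVec_injective_of_isUnit hT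
    · rw [Matrix.mul_one, ← Matrix.sub_mul, ← Matrix.mul_sub, ← Matrix.mul_assoc,
        Matrix.mul_assoc (T⁻¹ * (J - R)), hc, Matrix.mul_one]

theorem exists_diagonalization_of_isDHForm_posDef (h : IsDHForm (fun Q => Q.PosDef) E A) :
    ∃ (T : Matrix (Fin n) (Fin n) ℂ) (d : Fin n → ℝ), IsUnit T ∧ (∀ i, 0 ≤ d i) ∧
      T⁻¹ * E * T = diagonal fun i => (d i : ℂ) := by
  obtain ⟨T, E', A', hT, ⟨J, R, Q, -, -, hE, rfl, -⟩, rfl, -⟩ := isDHForm_posDef_iff.1 h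
  rw [conjTranspose_one, Matrix.one_mul] at hE
  have hdet := (isUnit_iff_isUnit_det T).1 hT
  have hTi : T * T⁻¹ = 1 := mul_nonsing_inv T hdet
  set U : Matrix (Fin n) (Fin n) ℂ := (hE.1.eigenvectorUnitary).1 with hU
  have hUU : Uᴴ * U = 1 := Unitary.coe_star_mul_self _
  have hUi : U⁻¹ = Uᴴ := inv_eq_left_inv hUU
  refine ⟨T⁻¹ * U, hE.1.eigenvalues, (isUnit_nonsing_inv_iff.2 hT).mul
    (IsUnit.of_mul_eq_one_right _ hUU), hE.eigenvalues_nonneg, ?_⟩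
  have hsp : E' = U * diagonal (fun i => (hE.1.eigenvalues i : ℂ)) * Uᴴ := by
    have := hE.1.spectral_theorem
    rwa [Unitary.conjStarAlgAut_apply] at this
  rw [Matrix.mul_inv_rev, hUi, nonsing_inv_nonsing_inv T hdet]
  have e : Uᴴ * T * (T⁻¹ * E' * T) * (T⁻¹ * U) =
      Uᴴ * ((T * T⁻¹) * E' * (T * T⁻¹)) * U := by simp only [Matrix.mul_assoc]
  rw [e, hTi, Matrix.one_mul, Matrix.mul_one]
  conv_lhs => rw [hsp]
  rw [Matrix.mul_assoc U, ← Matrix.mul_assoc Uᴴ U, hUU, Matrix.one_mul, Matrix.mul_assoc, hUU, Matrix.mul_one]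

end DHForm

/-! ### Jordan chains read off from a Kronecker form -/

section Chains

theorem sum_jordanBlock_zero {V : Type*} [AddCommGroup V] [Module ℂ V] (z : ℂ) {k : ℕ}
    (hk : 0 < k) (w : Fin k → V) :
    ∑ l, jordanBlock z k l ⟨0, hk⟩ • w l = z • w ⟨0, hk⟩ := by
  rw [Finset.sum_eq_single ⟨0, hk⟩]
  · simp [jordanBlock]
  · intro l _ hl
    simp [jordanBlock, hl]
  · simp

theorem sum_jordanBlock_succ {V : Type*} [AddCommGroup V] [Module ℂ V] (z : ℂ) {k j : ℕ}
    (hj : j + 1 < k) (w : Fin k → V) :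
    ∑ l, jordanBlock z k l ⟨j + 1, hj⟩ • w l =
      z • w ⟨j + 1, hj⟩ + w ⟨j, Nat.lt_of_succ_lt hj⟩ := by
  have hne : (⟨j + 1, hj⟩ : Fin k) ≠ ⟨j, Nat.lt_of_succ_lt hj⟩ := by simp
  rw [← Finset.sum_subset (Finset.subset_univ {⟨j + 1, hj⟩, ⟨j, Nat.lt_of_succ_lt hj⟩}),
    Finset.sum_pair hne]
  · simp [jordanBlock]
  · intro l _ hl
    simp only [Finset.mem_insert, Finset.mem_singleton, not_or, Fin.ext_iff] at hl
    simp [jordanBlock, Fin.ext_iff, hl.1, hl.2]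

theorem sum_one_smul {V : Type*} [AddCommGroup V] [Module ℂ V] {k : ℕ} (w : Fin k → V)
    (j : Fin k) : ∑ l, (1 : Matrix (Fin k) (Fin k) ℂ) l j • w l = w j := by
  simp [Matrix.one_apply]

variable {n : ℕ} {E A : Matrix (Fin n) (Fin n) ℂ}

/-- Written as `M T = S⁻¹ · diag(B)`, the identity expresses `M` between two bases, the columns of
`T` and those of `S⁻¹`. -/
theorem mulVec_col_of_mul_eq {m : ℕ} {s : Fin m → ℕ} {M S T : Matrix (Fin n) (Fin n) ℂ}
    (hS : IsUnit S) (e : (Σ i : Fin m, Fin (s i)) ≃ Fin n)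
    {B : ∀ i, Matrix (Fin (s i)) (Fin (s i)) ℂ}
    (h : S * M * T = Matrix.reindex e e (blockDiagonal' B)) (i : Fin m) (j : Fin (s i)) :
    M *ᵥ T.col (e ⟨i, j⟩) = ∑ l, B i l j • S⁻¹.col (e ⟨i, l⟩) := by
  have hMT : M * T = S⁻¹ * Matrix.reindex e e (blockDiagonal' B) := by
    rw [← h, ← Matrix.mul_assoc, ← Matrix.mul_assoc,
      nonsing_inv_mul S ((isUnit_iff_isUnit_det S).1 hS), Matrix.one_mul]
  ext r
  have hr := congrFun (congrFun hMT r) (e ⟨i, j⟩)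
  rw [mul_apply, mul_apply] at hr
  rw [mulVec, dotProduct]
  simp only [col_apply, Finset.sum_apply, Pi.smul_apply, smul_eq_mul]
  rw [hr, ← e.sum_comp, Fintype.sum_sigma, Finset.sum_eq_single i]
  · simp [blockDiagonal'_apply_eq, mul_comm]
  · intro i' _ hi'
    refine Finset.sum_eq_zero fun l _ => ?_
    simp [blockDiagonal'_apply_ne _ _ _ hi']
  · simp

/-- The Jordan chain (finite or infinite) belonging to a block of the Kronecker form. -/
theorem HasKroneckerBlock.exists_chain {c : KroneckerBlock} (h : HasKroneckerBlock E A c) :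
    0 < c.size ∧ ∃ u w : Fin c.size → Fin n → ℂ, (∀ j, u j ≠ 0) ∧
      (∀ j, E *ᵥ u j = ∑ l, c.matE l j • w l) ∧ ∀ j, A *ᵥ u j = ∑ l, c.matA l j • w l := by
  obtain ⟨m, b, ⟨hpos, e, S, T, hS, hT, hE, hA⟩, i, rfl⟩ := h
  refine ⟨hpos i, fun j => T.col (e ⟨i, j⟩), fun l => S⁻¹.col (e ⟨i, l⟩), fun j h0 => ?_,
    fun j => mulVec_col_of_mul_eq hS e hE i j, fun j => mulVec_col_of_mul_eq hS e hA i j⟩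
  have hinj := mulVec_injective_of_isUnit hT
  have h1 : T *ᵥ Pi.single (e ⟨i, j⟩) 1 = T *ᵥ 0 := by
    rw [mulVec_single_one, mulVec_zero]; exact h0
  have := congrFun (hinj h1) (e ⟨i, j⟩)
  simp at this

end Chains

/-! ### Energy estimates excluding inadmissible eigenvalues and chains -/

section Dissipative

variable {ι : Type*} [Fintype ι] {E J R : Matrix ι ι ℂ}

theorem star_dotProduct_mulVec_comm (M : Matrix ι ι ℂ) (v w : ι → ℂ) :
    star v ⬝ᵥ (M *ᵥ w) = star (star w ⬝ᵥ (Mᴴ *ᵥ v)) := by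
  rw [star_dotProduct, star_mulVec, dotProduct_mulVec]

theorem skew_re_dotProduct_mulVec (hJ : Jᴴ = -J) (v : ι → ℂ) : (star v ⬝ᵥ (J *ᵥ v)).re = 0 := by
  have h := star_dotProduct_mulVec_comm J v v
  rw [hJ, neg_mulVec, dotProduct_neg, star_neg] at h
  have := congrArg Complex.re h
  simp at this
  linarith

/-- The energy identity `Re z · v* E v = - v* R v` for `(J - R) v = z E v`. -/
theorem re_mul_dotProduct_of_eigenvector (hE : E.PosSemidef) (hJ : Jᴴ = -J) {z : ℂ} {v : ι → ℂ}
    (hv : (J - R) *ᵥ v = z • (E *ᵥ v)) :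
    z.re * (star v ⬝ᵥ (E *ᵥ v)).re = -(star v ⬝ᵥ (R *ᵥ v)).re := by
  have h := congrArg (fun x => (star v ⬝ᵥ x).re) hv
  have him := (Complex.le_def.1 (hE.dotProduct_mulVec_nonneg v)).2
  simp only [sub_mulVec, dotProduct_sub, dotProduct_smul, Complex.sub_re, smul_eq_mul,
    Complex.mul_re, skew_re_dotProduct_mulVec hJ] at h
  rw [← him] at h
  simp at h
  linarith

theorem Matrix.PosSemidef.mulVec_eq_zero_of_re {M : Matrix ι ι ℂ} (hM : M.PosSemidef)
    {v : ι → ℂ} (h : (star v ⬝ᵥ (M *ᵥ v)).re = 0) : M *ᵥ v = 0 := by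
  refine (hM.dotProduct_mulVec_zero_iff v).1 (Complex.ext h ?_)
  exact (Complex.le_def.1 (hM.dotProduct_mulVec_nonneg v)).2.symm

theorem Matrix.PosSemidef.re_dotProduct_mulVec_nonneg {M : Matrix ι ι ℂ} (hM : M.PosSemidef)
    (v : ι → ℂ) : 0 ≤ (star v ⬝ᵥ (M *ᵥ v)).re :=
  (Complex.le_def.1 (hM.dotProduct_mulVec_nonneg v)).1

/-- An eigenvector of a regular dissipative pencil has positive energy. -/
theorem energy_pos_of_eigenvector (hE : E.PosSemidef)
    (hker : ∀ v, E *ᵥ v = 0 → (J - R) *ᵥ v = 0 → v = 0) {z : ℂ} {v : ι → ℂ} (hv0 : v ≠ 0)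
    (hv : (J - R) *ᵥ v = z • (E *ᵥ v)) : 0 < (star v ⬝ᵥ (E *ᵥ v)).re := by
  refine lt_of_le_of_ne (hE.re_dotProduct_mulVec_nonneg v) fun h => hv0 ?_
  have hEv := hE.mulVec_eq_zero_of_re h.symm
  exact hker v hEv (by rw [hv, hEv, smul_zero])

theorem re_nonpos_of_eigenvector (hE : E.PosSemidef) (hJ : Jᴴ = -J) (hR : R.PosSemidef)
    (hker : ∀ v, E *ᵥ v = 0 → (J - R) *ᵥ v = 0 → v = 0) {z : ℂ} {v : ι → ℂ} (hv0 : v ≠ 0)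
    (hv : (J - R) *ᵥ v = z • (E *ᵥ v)) : z.re ≤ 0 := by
  have h1 := energy_pos_of_eigenvector hE hker hv0 hv
  have h2 := re_mul_dotProduct_of_eigenvector hE hJ hv
  have h3 := hR.re_dotProduct_mulVec_nonneg v
  by_contra hz
  nlinarith [mul_pos (not_le.1 hz) h1]

theorem no_imaginary_chain_of_length_two (hE : E.PosSemidef) (hJ : Jᴴ = -J)
    (hR : R.PosSemidef) (hker : ∀ v, E *ᵥ v = 0 → (J - R) *ᵥ v = 0 → v = 0) {z : ℂ}
    (hz : z.re = 0) {v w : ι → ℂ} (hv0 : v ≠ 0) (hv : (J - R) *ᵥ v = z • (E *ᵥ v))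
    (hw : (J - R) *ᵥ w = z • (E *ᵥ w) + E *ᵥ v) : False := by
  have h1 := energy_pos_of_eigenvector hE hker hv0 hv
  have h2 := re_mul_dotProduct_of_eigenvector hE hJ hv
  rw [hz, zero_mul, eq_comm, neg_eq_zero] at h2
  have hRv := hR.mulVec_eq_zero_of_re h2
  rw [sub_mulVec, hRv, sub_zero] at hv
  have hzc : star z = -z := by
    apply Complex.ext <;> simp [hz]
  -- Since `Jv = zEv` and `star z = -z`, `v*Jw = z v*Ew`. These terms cancel, leaving `v*Ev = 0`.
  have h3 := congrArg (fun x => star v ⬝ᵥ x) hw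
  simp only [sub_mulVec, dotProduct_sub, dotProduct_add, dotProduct_smul] at h3
  rw [star_dotProduct_mulVec_comm J v w, star_dotProduct_mulVec_comm R v w,
    star_dotProduct_mulVec_comm E v w, hJ, hR.1.eq, hE.1.eq, hRv, neg_mulVec, hv] at h3
  simp only [dotProduct_neg, dotProduct_smul, star_neg, dotProduct_zero, smul_eq_mul, star_mul,
    hzc, star_zero] at h3
  have h4 : star v ⬝ᵥ (E *ᵥ v) = 0 := by linear_combination -h3
  rw [h4] at h1
  simp at h1

theorem no_infinite_chain_of_length_three (hE : E.PosSemidef) (hJ : Jᴴ = -J)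
    (hR : R.PosSemidef) (hker : ∀ v, E *ᵥ v = 0 → (J - R) *ᵥ v = 0 → v = 0)
    {v₀ v₁ v₂ : ι → ℂ} (hv0 : v₀ ≠ 0) (h0 : E *ᵥ v₀ = 0) (h1 : E *ᵥ v₁ = (J - R) *ᵥ v₀)
    (h2 : E *ᵥ v₂ = (J - R) *ᵥ v₁) : False := by
  -- As `E` is Hermitian, its kernel is orthogonal to its range.
  have hE0 : ∀ w, star v₀ ⬝ᵥ (E *ᵥ w) = 0 := fun w => by
    rw [star_dotProduct_mulVec_comm, hE.1.eq, h0, dotProduct_zero, star_zero]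
  have h3 : star v₀ ⬝ᵥ ((J - R) *ᵥ v₀) = 0 := by rw [← h1, hE0]
  have hRv : R *ᵥ v₀ = 0 := by
    refine hR.mulVec_eq_zero_of_re ?_
    have := congrArg Complex.re h3
    rw [sub_mulVec, dotProduct_sub, Complex.sub_re, skew_re_dotProduct_mulVec hJ] at this
    simpa using this
  -- As `Rv₀ = 0`, this turns into `v₁*Jv₀ = 0`. But `Jv₀ = Ev₁`, hence `v₁*Ev₁ = 0` and `Ev₁ = 0`,
  -- so `v₀` is a common null vector.
  have h4 : star v₀ ⬝ᵥ ((J - R) *ᵥ v₁) = 0 := by rw [← h2, hE0]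
  rw [sub_mulVec, dotProduct_sub, star_dotProduct_mulVec_comm R, hR.1.eq, hRv, dotProduct_zero,
    star_zero, sub_zero, star_dotProduct_mulVec_comm, hJ, neg_mulVec, dotProduct_neg, star_neg,
    neg_eq_zero, star_eq_zero] at h4
  rw [sub_mulVec, hRv, sub_zero] at h1
  have hEv : E *ᵥ v₁ = 0 := (hE.dotProduct_mulVec_zero_iff v₁).1 (by rw [h1, h4])
  exact hv0 (hker v₀ h0 (by rw [sub_mulVec, hRv, sub_zero, ← h1, hEv]))

end Dissipative

/-! ### One Kronecker block for each cyclic summand -/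

section Cyclic

open Module

variable {W : Type*} [AddCommGroup W] [Module ℂ W]

/-- Applying `N ^ (k - 1 - j)` to a linear relation kills the terms beyond `j`; the earlier
coefficients vanish by induction. -/
theorem linearIndependent_pow_apply_of_nilpotent {N : End ℂ W} {k : ℕ} {v : W}
    (hN : N ^ k = 0) (hv : (N ^ (k - 1)) v ≠ 0) :
    LinearIndependent ℂ fun j : Fin k => (N ^ (j : ℕ)) v := by
  rw [Fintype.linearIndependent_iff]
  intro c hc
  have key : ∀ j : ℕ, ∀ hj : j < k, c ⟨j, hj⟩ = 0 := by
    intro j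
    induction j using Nat.strong_induction_on with
    | _ j ih =>
      intro hj
      have h := congrArg (N ^ (k - 1 - j)) hc
      rw [map_sum, map_zero, Finset.sum_eq_single ⟨j, hj⟩] at h
      · rw [map_smul, ← Module.End.mul_apply, ← pow_add, Nat.sub_add_cancel (by omega)] at h
        exact (smul_eq_zero.1 h).resolve_right hv
      · intro l _ hl
        rcases lt_or_gt_of_ne (fun h => hl (Fin.ext h) : (l : ℕ) ≠ j) with hlt | hlt
        · rw [ih l hlt l.2, zero_smul, map_zero]
        · rw [map_smul, ← Module.End.mul_apply, ← pow_add,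
            show k - 1 - j + (l : ℕ) = k + (k - 1 - j + l - k) by omega, pow_add, hN]
          simp
      · simp
  exact fun j => key j j.2

/-- A nilpotent endomorphism of maximal index is a Jordan block in a suitable basis. -/
theorem exists_basis_jordanBlock_zero [FiniteDimensional ℂ W] {N : End ℂ W} {k : ℕ}
    (hfin : finrank ℂ W = k) (hN : N ^ k = 0) (hN' : k ≠ 0 → N ^ (k - 1) ≠ 0) :
    ∃ u : Basis (Fin k) ℂ W, ∀ j, N (u j) = ∑ l, jordanBlock 0 k l j • u l := by
  rcases Nat.eq_zero_or_pos k with rfl | hk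
  · exact ⟨finBasisOfFinrankEq ℂ W hfin, fun j => j.elim0⟩
  obtain ⟨v, hv⟩ : ∃ v, (N ^ (k - 1)) v ≠ 0 := by
    by_contra! h
    exact hN' hk.ne' (LinearMap.ext h)
  -- The order is reversed because the upper triangular block sends each basis vector to its
  -- predecessor.
  have hli := (linearIndependent_pow_apply_of_nilpotent hN hv).comp _ Fin.rev_injective
  have : Nonempty (Fin k) := ⟨⟨0, hk⟩⟩
  have hu : ∀ j, basisOfLinearIndependentOfCardEqFinrank hli (by simp [hfin]) j =
      (N ^ (k - 1 - (j : ℕ))) v := fun j => by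
    rw [basisOfLinearIndependentOfCardEqFinrank, Basis.mk_apply]
    simp only [Function.comp_apply, Fin.val_rev]
    congr 2
    omega
  refine ⟨basisOfLinearIndependentOfCardEqFinrank hli (by simp [hfin]), ?_⟩
  rintro ⟨j, hj⟩
  rw [hu, ← Module.End.mul_apply, ← pow_succ']
  cases j with
  | zero =>
    rw [sum_jordanBlock_zero, zero_smul]
    simp [Nat.sub_add_cancel hk, hN]
  | succ j =>
    rw [sum_jordanBlock_succ, zero_smul, zero_add, hu]
    congr 2
    simp only
    omega

/-- Since `U` commutes with `M`, the map `U⁻¹M` is nilpotent of the same index; its Jordan basis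
serves. -/
theorem exists_basis_jordanBlock_zero_of_commute [FiniteDimensional ℂ W] {M U : End ℂ W} {k : ℕ}
    (hU : IsUnit U) (hc : Commute U M)
    (hfin : finrank ℂ W = k) (hM : M ^ k = 0) (hM' : k ≠ 0 → M ^ (k - 1) ≠ 0) :
    ∃ u : Basis (Fin k) ℂ W, ∀ j, M (u j) = U (∑ l, jordanBlock 0 k l j • u l) := by
  obtain ⟨U, rfl⟩ := hU
  have hc' : Commute (↑U⁻¹ : End ℂ W) M := hc.units_inv_left
  obtain ⟨u, hu⟩ := exists_basis_jordanBlock_zero (N := (↑U⁻¹ : End ℂ W) * M) hfin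
    (by rw [hc'.mul_pow, hM, mul_zero])
    (fun hk h => hM' hk (by
      rw [hc'.mul_pow, ← Units.val_pow_eq_pow_val, Units.mul_right_eq_zero] at h
      exact h))
  refine ⟨u, fun j => ?_⟩
  rw [← hu, ← Module.End.mul_apply, ← mul_assoc, Units.mul_inv, one_mul]

/-- The pencil `λ M - (z₀ M - 1)`, where `M - μ` is nilpotent of maximal index, is equivalent to a
single Kronecker block. -/
theorem exists_kroneckerBlock_of_isNilpotent [FiniteDimensional ℂ W] {M : End ℂ W} {k : ℕ}
    (z₀ μ : ℂ) (hfin : finrank ℂ W = k) (hM : (M - algebraMap ℂ _ μ) ^ k = 0)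
    (hM' : k ≠ 0 → (M - algebraMap ℂ _ μ) ^ (k - 1) ≠ 0) :
    ∃ (b : KroneckerBlock) (u w : Basis (Fin b.size) ℂ W),
      (∀ j, M (u j) = ∑ l, b.matE l j • w l) ∧
      ∀ j, z₀ • M (u j) - u j = ∑ l, b.matA l j • w l := by
  by_cases hμ : μ = 0
  · subst hμ
    rw [map_zero, sub_zero] at hM hM'
    -- Here `z₀M - 1` is invertible. Taking it as `U` and as the map from `u` to `w` makes the `A`
    -- part the identity: a block at infinity.
    have hU : IsUnit (z₀ • M - 1) :=
      IsNilpotent.isUnit_sub_one ⟨k, by rw [smul_pow, hM, smul_zero]⟩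
    have hc : Commute (z₀ • M - 1) M :=
      ((Commute.refl M).smul_left z₀).sub_left (Commute.one_left M)
    obtain ⟨u, hu⟩ := exists_basis_jordanBlock_zero_of_commute hU hc hfin hM hM'
    let U := LinearEquiv.ofBijective _ ((Module.End.isUnit_iff _).1 hU)
    have hE : ∀ j, M (u j) = ∑ l, jordanBlock 0 k l j • u.map U l := fun j => by
      simp only [Basis.map_apply, U, LinearEquiv.ofBijective_apply, hu j, map_sum, map_smul]
    have hA : ∀ j, z₀ • M (u j) - u j =
        ∑ l, (1 : Matrix (Fin k) (Fin k) ℂ) l j • u.map U l := fun j => by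
      rw [sum_one_smul]
      simp [U]
    exact ⟨KroneckerBlock.infinite k, u, u.map U, hE, hA⟩
  · have hMU : IsUnit M := by
      have h1 : IsUnit (algebraMap ℂ (End ℂ W) μ) := (isUnit_iff_ne_zero.2 hμ).map _
      have := IsNilpotent.isUnit_add_left_of_commute ⟨k, hM⟩ h1
        (Algebra.commutes μ _).symm
      simpa using this
    -- The identity `z₀M - 1 = (z₀ - μ⁻¹)M + μ⁻¹(M - μ)` locates the eigenvalue. Choosing `U = μM`
    -- gives `μ⁻¹(M - μ)u_j = M u_{j-1} = w_{j-1}`, so the superdiagonal entries are exactly one.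
    have hU : IsUnit (μ • M) := by
      rw [Algebra.smul_def]
      exact ((isUnit_iff_ne_zero.2 hμ).map _).mul hMU
    have hc : Commute (μ • M) (M - algebraMap ℂ _ μ) :=
      ((Commute.refl M).sub_right (Algebra.commutes μ _).symm).smul_left μ
    obtain ⟨u, hu⟩ := exists_basis_jordanBlock_zero_of_commute hU hc hfin hM hM'
    let U := LinearEquiv.ofBijective _ ((Module.End.isUnit_iff _).1 hMU)
    have hE : ∀ j, M (u j) = ∑ l, (1 : Matrix (Fin k) (Fin k) ℂ) l j • u.map U l := fun j => by
      rw [sum_one_smul]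
      simp [U]
    have hA : ∀ j, z₀ • M (u j) - u j = ∑ l, jordanBlock (z₀ - μ⁻¹) k l j • u.map U l := by
      intro j
      have h : ∑ l, jordanBlock (z₀ - μ⁻¹) k l j • u.map U l =
          (z₀ - μ⁻¹) • M (u j) + M (∑ l, jordanBlock 0 k l j • u l) := by
        obtain ⟨j, hj⟩ := j
        cases j with
        | zero => rw [sum_jordanBlock_zero, sum_jordanBlock_zero]; simp [U]
        | succ j => rw [sum_jordanBlock_succ, sum_jordanBlock_succ]; simp [U]
      have h2 := congrArg (μ⁻¹ • ·) (hu j)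
      simp only [LinearMap.smul_apply, inv_smul_smul₀ hμ] at h2
      rw [h, ← h2, LinearMap.sub_apply, Module.algebraMap_end_apply, smul_sub, inv_smul_smul₀ hμ,
        sub_smul]
      abel
    exact ⟨KroneckerBlock.finite (z₀ - μ⁻¹) k, u, u.map U, hE, hA⟩

open Polynomial in
-- Over `ℂ` an irreducible `p` is associated to some `X - μ`, which acts on the quotient nilpotently
-- with index exactly `k`. The exponent `k = 0` is allowed and gives an empty block.
theorem exists_kroneckerBlock_quotient (z₀ : ℂ) {p : ℂ[X]} (hp : Irreducible p) (k : ℕ) :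
    ∃ (b : KroneckerBlock) (u w : Basis (Fin b.size) ℂ (ℂ[X] ⧸ Submodule.span ℂ[X] {p ^ k})),
      (∀ j, (X : ℂ[X]) • u j = ∑ l, b.matE l j • w l) ∧
      ∀ j, z₀ • (X : ℂ[X]) • u j - u j = ∑ l, b.matA l j • w l := by
  obtain ⟨μ, hμ⟩ := IsAlgClosed.exists_root p
    (by rw [IsAlgClosed.degree_eq_one_of_irreducible ℂ hp]; exact one_ne_zero)
  have hassoc : Associated (X - C μ) p :=
    (irreducible_X_sub_C μ).associated_of_dvd hp (dvd_iff_isRoot.2 hμ)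
  have hspan : Submodule.span ℂ[X] {p ^ k} = Submodule.span ℂ[X] {(X - C μ) ^ k} :=
    (Ideal.span_singleton_eq_span_singleton.2 (hassoc.pow_pow (n := k))).symm
  rw [hspan]
  set I : Ideal ℂ[X] := Submodule.span ℂ[X] {(X - C μ) ^ k} with hI
  have hmonic : ((X - C μ) ^ k).Monic := (monic_X_sub_C μ).pow k
  have hfin : finrank ℂ (ℂ[X] ⧸ I) = k := by
    rw [hI]
    refine (finrank_quotient_span_eq_natDegree (f := (X - C μ) ^ k)).trans ?_
    rw [natDegree_pow, natDegree_X_sub_C, mul_one]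
  have : FiniteDimensional ℂ (ℂ[X] ⧸ I) :=
    hmonic.finite_quotient
  let φ : ℂ[X] →ₐ[ℂ] End ℂ (ℂ[X] ⧸ I) := Algebra.lsmul ℂ ℂ (ℂ[X] ⧸ I)
  have hφ : ∀ i : ℕ, (φ X - algebraMap ℂ _ μ) ^ i = φ ((X - C μ) ^ i) := fun i => by
    rw [map_pow, map_sub, ← Polynomial.algebraMap_eq, AlgHom.commutes]
  refine exists_kroneckerBlock_of_isNilpotent (M := φ X) z₀ μ hfin ?_ fun hk h => ?_
  · rw [hφ]
    refine LinearMap.ext fun x => ?_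
    obtain ⟨x, rfl⟩ := Submodule.Quotient.mk_surjective _ x
    refine (Submodule.Quotient.mk_eq_zero I (x := (X - C μ) ^ k • x)).2 ?_
    exact Ideal.mul_mem_right _ _ (Ideal.mem_span_singleton_self _)
  · rw [hφ] at h
    -- The class of `1` is a cyclic vector; that `(X - μ)^(k-1)` does not kill it follows by
    -- comparing degrees.
    have h1 : (Submodule.Quotient.mk ((X - C μ) ^ (k - 1) • 1) : ℂ[X] ⧸ I) = 0 :=
      congrArg (fun f => f (Submodule.Quotient.mk 1)) h
    rw [Submodule.Quotient.mk_eq_zero, smul_eq_mul, mul_one] at h1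
    have h2 := natDegree_le_of_dvd (Ideal.mem_span_singleton.1 h1)
      (pow_ne_zero _ (X_sub_C_ne_zero μ))
    simp only [natDegree_pow, natDegree_X_sub_C, mul_one] at h2
    omega

end Cyclic

/-! ### Existence of the Weierstrass canonical form -/

section Existence

open Module

variable {n : ℕ} {E A : Matrix (Fin n) (Fin n) ℂ}

theorem isUnit_of_basis {κ : Type*} (u : Basis κ ℂ (Fin n → ℂ)) (e : κ ≃ Fin n) :
    IsUnit (Matrix.of fun r c => u (e.symm c) r) := by
  rw [← linearIndependent_cols_iff_isUnit]
  exact u.linearIndependent.comp _ e.symm.injective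

theorem mul_eq_of_bases {m : ℕ} {s : Fin m → ℕ} {M : Matrix (Fin n) (Fin n) ℂ}
    (u w : (Σ i : Fin m, Fin (s i)) → Fin n → ℂ) (e : (Σ i : Fin m, Fin (s i)) ≃ Fin n)
    {B : ∀ i, Matrix (Fin (s i)) (Fin (s i)) ℂ}
    (h : ∀ i j, M *ᵥ u ⟨i, j⟩ = ∑ l, B i l j • w ⟨i, l⟩) :
    M * (Matrix.of fun r c => u (e.symm c) r) =
      (Matrix.of fun r c => w (e.symm c) r) * Matrix.reindex e e (blockDiagonal' B) := by
  ext r c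
  obtain ⟨⟨i, j⟩, rfl⟩ := e.surjective c
  have hr := congrFun (h i j) r
  have hl : ∀ x, (Matrix.of fun r c => u (e.symm c) r) x (e ⟨i, j⟩) = u ⟨i, j⟩ x := fun x => by
    rw [of_apply, e.symm_apply_apply]
  rw [mul_apply, mul_apply]
  simp only [hl]
  refine hr.trans ?_
  rw [← e.sum_comp, Fintype.sum_sigma, Finset.sum_eq_single i]
  · simp [Finset.sum_apply, mul_comm, blockDiagonal'_apply_eq]
  · intro i' _ hi'
    refine Finset.sum_eq_zero fun l _ => ?_
    simp [blockDiagonal'_apply_ne _ _ _ hi']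
  · simp

/-- The columns of `T` are the `u`'s and those of `S⁻¹` are the `w`'s, which reverses the extraction
of chains. -/
theorem isKroneckerForm_of_bases {m : ℕ} {b : Fin m → KroneckerBlock} (hb : ∀ i, 0 < (b i).size)
    (u w : Basis (Σ i : Fin m, Fin (b i).size) ℂ (Fin n → ℂ))
    (hE : ∀ i j, E *ᵥ u ⟨i, j⟩ = ∑ l, (b i).matE l j • w ⟨i, l⟩)
    (hA : ∀ i j, A *ᵥ u ⟨i, j⟩ = ∑ l, (b i).matA l j • w ⟨i, l⟩) :
    IsKroneckerForm E A b := by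
  let e := u.indexEquiv (Pi.basisFun ℂ (Fin n))
  have hW := isUnit_of_basis w e
  have hWi := nonsing_inv_mul _ ((isUnit_iff_isUnit_det _).1 hW)
  refine ⟨hb, e, (Matrix.of fun r c => w (e.symm c) r)⁻¹, Matrix.of fun r c => u (e.symm c) r,
    isUnit_nonsing_inv_iff.2 hW, isUnit_of_basis u e, ?_, ?_⟩
  · rw [Matrix.mul_assoc, mul_eq_of_bases u w e hE, ← Matrix.mul_assoc, hWi, Matrix.one_mul]
  · rw [Matrix.mul_assoc, mul_eq_of_bases u w e hA, ← Matrix.mul_assoc, hWi, Matrix.one_mul]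

/-- Blocks of size zero may be discarded from a Kronecker form. -/
theorem exists_isKroneckerForm_of_bases {ι : Type*} [Fintype ι] (b : ι → KroneckerBlock)
    (u w : Basis (Σ i, Fin (b i).size) ℂ (Fin n → ℂ))
    (hE : ∀ i j, E *ᵥ u ⟨i, j⟩ = ∑ l, (b i).matE l j • w ⟨i, l⟩)
    (hA : ∀ i j, A *ᵥ u ⟨i, j⟩ = ∑ l, (b i).matA l j • w ⟨i, l⟩) :
    ∃ (m : ℕ) (b' : Fin m → KroneckerBlock), IsKroneckerForm E A b' := by
  classical
  let ψ := (Fintype.equivFin {i // 0 < (b i).size}).symm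
  let b' := fun i => b (ψ i)
  let F : (Σ i, Fin (b' i).size) → Σ i, Fin (b i).size := fun x => ⟨ψ x.1, x.2⟩
  have hF : F.Bijective := by
    constructor
    · rintro ⟨i, j⟩ ⟨i', j'⟩ h
      obtain ⟨h1, h2⟩ := Sigma.mk.inj_iff.1 h
      obtain rfl : i = i' := ψ.injective (Subtype.ext h1)
      exact Sigma.ext rfl h2
    · rintro ⟨i, j⟩
      obtain ⟨x, hx⟩ := ψ.surjective ⟨i, j.pos⟩
      have hi : (ψ x : ι) = i := congrArg Subtype.val hx
      subst hi
      exact ⟨⟨x, j⟩, rfl⟩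
  let e := (Equiv.ofBijective F hF).symm
  refine ⟨_, b', isKroneckerForm_of_bases (fun i => (ψ i).2) (u.reindex e) (w.reindex e) ?_ ?_⟩
  · intro i j
    simpa [e, F] using hE (ψ i) j
  · intro i j
    simpa [e, F] using hA (ψ i) j

open Polynomial in
/-- The Weierstrass canonical form of a regular pencil. -/
theorem PencilRegular.exists_isKroneckerForm (hreg : PencilRegular E A) :
    ∃ (m : ℕ) (b : Fin m → KroneckerBlock), IsKroneckerForm E A b := by
  classical
  obtain ⟨z₀, hz⟩ := hreg
  set G := z₀ • E - A with hG
  have hGu : IsUnit G.det := isUnit_iff_ne_zero.2 hz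
  -- With this `φ`, `E = Gφ` and `A = G(z₀φ - 1)`, so both coefficients are determined by `φ` up to
  -- the left factor `G`.
  let φ : End ℂ (Fin n → ℂ) := Matrix.toLin' (G⁻¹ * E)
  obtain ⟨ι, _, p, hp, k, ⟨f⟩⟩ := Module.equiv_directSum_of_isTorsion
    (Module.AEval.isTorsion_of_finiteDimensional ℂ (Fin n → ℂ) φ)
  choose b u w huE huA using fun i => exists_kroneckerBlock_quotient z₀ (hp i) (k i)
  let V : ι → Type := fun i => ℂ[X] ⧸ Submodule.span ℂ[X] {p i ^ k i}
  let g₀ : (∀ i, V i) ≃ₗ[ℂ[X]] AEval ℂ (Fin n → ℂ) φ :=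
    (DirectSum.linearEquivFunOnFintype ℂ[X] ι V).symm ≪≫ₗ f.symm
  let g : (∀ i, V i) ≃ₗ[ℂ] (Fin n → ℂ) :=
    g₀.restrictScalars ℂ ≪≫ₗ (AEval.of ℂ (Fin n → ℂ) φ).symm
  have hg : ∀ x, φ (g x) = g ((X : ℂ[X]) • x) := fun x => by
    change _ = (AEval.of ℂ (Fin n → ℂ) φ).symm (g₀ ((X : ℂ[X]) • x))
    rw [map_smul]
    exact (AEval.of_symm_X_smul φ (g₀ x)).symm
  let Γ : (Fin n → ℂ) ≃ₗ[ℂ] (Fin n → ℂ) := Matrix.toLinearEquiv' G (invertibleOfIsUnitDet G hGu)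
  have hΓ : ∀ x, Γ x = G *ᵥ x := fun x => rfl
  have hEφ : ∀ x, E *ᵥ x = Γ (φ x) := fun x => by
    rw [hΓ, toLin'_apply, mulVec_mulVec, ← Matrix.mul_assoc, mul_nonsing_inv G hGu,
      Matrix.one_mul]
  have hAφ : ∀ x, A *ᵥ x = Γ (z₀ • φ x - x) := fun x => by
    rw [map_sub, map_smul, ← hEφ, hΓ, hG, sub_mulVec, smul_mulVec, sub_sub_cancel]
  have hsum : ∀ (i : ι) (c : Fin (b i).size → ℂ),
      Γ (g (Pi.single i (∑ l, c l • w i l))) =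
        ∑ l, c l • ((Pi.basis w).map g).map Γ ⟨i, l⟩ := fun i c => by
    have : (Pi.single i (∑ l, c l • w i l) : ∀ i, V i) = ∑ l, c l • Pi.single i (w i l) := by
      rw [← LinearMap.single_apply ℂ, map_sum]
      simp
    rw [this]
    simp [Pi.basis_apply]
  have hu : ∀ i j, (Pi.basis u).map g ⟨i, j⟩ = g (Pi.single i (u i j)) := fun i j => by
    rw [Basis.map_apply, Pi.basis_apply]
  have hφu : ∀ i j, φ ((Pi.basis u).map g ⟨i, j⟩) = g (Pi.single i ((X : ℂ[X]) • u i j)) :=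
    fun i j => by
      rw [hu, hg]
      exact congrArg g (Pi.single_smul (f := V) i (X : ℂ[X]) (u i j)).symm
  refine exists_isKroneckerForm_of_bases b ((Pi.basis u).map g) (((Pi.basis w).map g).map Γ)
    (fun i j => ?_) fun i j => ?_
  · rw [← hsum, ← huE, hEφ, hφu]
  · rw [← hsum, ← huA, hAφ, hφu, hu, ← map_smul g, ← map_sub g, Pi.single_sub]
    congr 3
    exact (Pi.single_smul (f := V) i z₀ ((X : ℂ[X]) • u i j)).symm

end Existence

/-! ### Dissipative representatives of the admissible blocks -/

section Blocks

theorem jordanBlock_eq_smul_one_add (z : ℂ) (k : ℕ) :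
    jordanBlock z k = z • (1 : Matrix (Fin k) (Fin k) ℂ) + jordanBlock 0 k := by
  ext i j
  by_cases h : i = j <;> simp [jordanBlock, h]

theorem diagonal_conj_jordanBlock_zero {ε : ℂ} (hε : ε ≠ 0) (k : ℕ) :
    diagonal (fun i : Fin k => (ε ^ (i : ℕ))⁻¹) * jordanBlock 0 k *
      diagonal (fun i : Fin k => ε ^ (i : ℕ)) = ε • jordanBlock 0 k := by
  ext i j
  rw [mul_diagonal, diagonal_mul, Matrix.smul_apply]
  simp only [jordanBlock, of_apply]
  split_ifs with h1 h2
  · simp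
  · rw [← h2, pow_succ]
    have := pow_ne_zero (i : ℕ) hε
    field_simp
    simp
  · simp

/-- The shift is a partial isometry: `1 - NᴴN` is the projection onto the first coordinate. -/
theorem posSemidef_one_sub_jordanBlock_zero (k : ℕ) :
    (1 - (jordanBlock 0 k)ᴴ * jordanBlock 0 k).PosSemidef := by
  have h : 1 - (jordanBlock 0 k)ᴴ * jordanBlock 0 k =
      diagonal fun i : Fin k => if (i : ℕ) = 0 then (1 : ℂ) else 0 := by
    ext i j
    rw [Matrix.sub_apply, mul_apply]
    obtain ⟨j, hj⟩ := j
    cases j with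
    | zero =>
      rw [Finset.sum_eq_zero]
      · by_cases hij : i = ⟨0, hj⟩
        · subst hij; simp
        · simp [hij]
      · intro l _
        simp [jordanBlock]
    | succ j =>
      rw [Finset.sum_eq_single ⟨j, Nat.lt_of_succ_lt hj⟩]
      · by_cases hij : i = ⟨j + 1, hj⟩
        · subst hij; simp [jordanBlock]
        · have h1 : ¬ (j + 1 = (i : ℕ)) := fun h => hij (Fin.ext h.symm)
          simp [jordanBlock, hij, h1]
      · intro l _ hl
        have h2 : ¬ ((l : ℕ) = j) := fun h => hl (Fin.ext h)
        simp [jordanBlock, Fin.ext_iff, h2]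
      · simp
  rw [h]
  refine PosSemidef.diagonal fun i => ?_
  dsimp only [Pi.zero_apply]
  split_ifs <;> simp

theorem posSemidef_two_sub_jordanBlock_zero (k : ℕ) :
    (2 - (jordanBlock 0 k + (jordanBlock 0 k)ᴴ)).PosSemidef := by
  have h : 2 - (jordanBlock 0 k + (jordanBlock 0 k)ᴴ) =
      (1 - jordanBlock 0 k)ᴴ * (1 - jordanBlock 0 k) +
        (1 - (jordanBlock 0 k)ᴴ * jordanBlock 0 k) := by
    rw [conjTranspose_sub, conjTranspose_one, ← one_add_one_eq_two]
    noncomm_ring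
  rw [h]
  exact (posSemidef_conjTranspose_mul_self _).add (posSemidef_one_sub_jordanBlock_zero k)

theorem isEquivDissipative_finite_of_re_neg {z : ℂ} (hz : z.re < 0) (k : ℕ) :
    IsEquivDissipative (1 : Matrix (Fin k) (Fin k) ℂ) (jordanBlock z k) := by
  have hε0 : ((-z.re : ℝ) : ℂ) ≠ 0 := by
    rw [Complex.ofReal_ne_zero]; linarith
  -- Diagonal scaling shrinks or stretches the superdiagonal to `ε = -Re z`, which makes minus twice
  -- the Hermitian part equal to `ε(2 - N - Nᴴ)`, with `N` the nilpotent shift.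
  set ε : ℂ := ((-z.re : ℝ) : ℂ) with hε
  have hinv : diagonal (fun i : Fin k => (ε ^ (i : ℕ))⁻¹) *
      diagonal (fun i : Fin k => ε ^ (i : ℕ)) = 1 := by
    rw [diagonal_mul_diagonal, ← diagonal_one]
    congr 1; funext i
    exact inv_mul_cancel₀ (pow_ne_zero _ hε0)
  refine ⟨diagonal fun i : Fin k => (ε ^ (i : ℕ))⁻¹, diagonal fun i : Fin k => ε ^ (i : ℕ),
    IsUnit.of_mul_eq_one _ hinv, IsUnit.of_mul_eq_one_right _ hinv, ?_, ?_⟩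
  · rw [Matrix.mul_one, hinv]
    exact PosSemidef.one
  · have h : -(diagonal (fun i : Fin k => (ε ^ (i : ℕ))⁻¹) * jordanBlock z k *
          diagonal (fun i : Fin k => ε ^ (i : ℕ)) +
        (diagonal (fun i : Fin k => (ε ^ (i : ℕ))⁻¹) * jordanBlock z k *
          diagonal (fun i : Fin k => ε ^ (i : ℕ)))ᴴ) =
        ε • (2 - (jordanBlock 0 k + (jordanBlock 0 k)ᴴ)) := by
      rw [jordanBlock_eq_smul_one_add z k, Matrix.mul_add, Matrix.add_mul,
        diagonal_conj_jordanBlock_zero hε0, Matrix.mul_smul, Matrix.smul_mul, Matrix.mul_one, hinv,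
        conjTranspose_add, conjTranspose_smul, conjTranspose_smul, conjTranspose_one]
      have h1 : star ε = ε := Complex.conj_ofReal _
      have h2 : z + star z = -(2 * ε) := by
        rw [hε]
        apply Complex.ext <;> simp; ring
      rw [h1, smul_sub, smul_add, ← one_add_one_eq_two, smul_add]
      have h3 : z • (1 : Matrix (Fin k) (Fin k) ℂ) + star z • 1 = -(ε • 1 + ε • 1) := by
        rw [← add_smul, h2, two_mul, neg_smul, add_smul]
      rw [eq_sub_iff_add_eq, ← neg_eq_iff_eq_neg.2 h3]
      abel
    rw [h]
    refine (posSemidef_two_sub_jordanBlock_zero k).smul ?_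
    rw [hε]
    exact_mod_cast (by linarith : (0 : ℝ) ≤ -z.re)

theorem isEquivDissipative_finite_one {z : ℂ} (hz : z.re = 0) :
    IsEquivDissipative (1 : Matrix (Fin 1) (Fin 1) ℂ) (jordanBlock z 1) := by
  refine ⟨1, 1, isUnit_one, isUnit_one, by simpa using PosSemidef.one, ?_⟩
  have : jordanBlock z 1 + (jordanBlock z 1)ᴴ = 0 := by
    ext i j
    have : z + star z = 0 := by apply Complex.ext <;> simp [hz]
    simpa [jordanBlock, Subsingleton.elim i j] using this
  rw [Matrix.one_mul, Matrix.mul_one, this, neg_zero]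
  exact PosSemidef.zero

theorem isEquivDissipative_infinite_one :
    IsEquivDissipative (jordanBlock 0 1) (1 : Matrix (Fin 1) (Fin 1) ℂ) := by
  have h0 : jordanBlock 0 1 = 0 := by
    ext i j
    simp [jordanBlock, Subsingleton.elim i j]
  refine ⟨-1, 1, isUnit_one.neg, isUnit_one, ?_, ?_⟩
  · rw [h0, Matrix.mul_zero, Matrix.zero_mul]
    exact PosSemidef.zero
  · have : -(-1 * 1 * 1 + (-1 * 1 * 1 : Matrix (Fin 1) (Fin 1) ℂ)ᴴ) = 1 + 1 := by
      simp
    rw [this]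
    exact PosSemidef.one.add PosSemidef.one

theorem isEquivDissipative_infinite_two :
    IsEquivDissipative (jordanBlock 0 2) (1 : Matrix (Fin 2) (Fin 2) ℂ) := by
  -- Left multiplication by this rotation makes the `A` part skew-Hermitian and turns the nilpotent
  -- `E` part into `diag(0, 1)`.
  refine ⟨!![0, -1; 1, 0], 1, ?_, isUnit_one, ?_, ?_⟩
  · rw [isUnit_iff_isUnit_det]
    simp
  · have : !![0, -1; 1, 0] * jordanBlock 0 2 * 1 = diagonal ![0, 1] := by
      have hJ : jordanBlock 0 2 = !![0, 1; 0, 0] := by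
        ext i j
        fin_cases i <;> fin_cases j <;> simp [jordanBlock]
      rw [hJ]
      ext i j
      fin_cases i <;> fin_cases j <;> simp
    rw [this]
    refine PosSemidef.diagonal fun i => ?_
    fin_cases i <;> simp
  · have : -((!![0, -1; 1, 0] : Matrix (Fin 2) (Fin 2) ℂ) * 1 * 1 +
        (!![0, -1; 1, 0] * 1 * 1)ᴴ) = 0 := by
      ext i j
      fin_cases i <;> fin_cases j <;> simp
    rw [this]
    exact PosSemidef.zero

end Blocks

/-! ### Spectral characterization for invertible `Q` -/

section Characterization

variable {n : ℕ} {E A : Matrix (Fin n) (Fin n) ℂ}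

theorem pencilEigenvalue_of_mulVec {z : ℂ} {v : Fin n → ℂ} (hv : v ≠ 0)
    (h : A *ᵥ v = z • (E *ᵥ v)) : PencilEigenvalue E A z := by
  refine exists_mulVec_eq_zero_iff.1 ⟨v, hv, ?_⟩
  rw [sub_mulVec, smul_mulVec, h, sub_self]

/-- The `E` part of the block is the identity, so `w = Eu` can be eliminated. -/
theorem HasKroneckerBlock.exists_finite_chain {z : ℂ} {k : ℕ}
    (h : HasKroneckerBlock E A (KroneckerBlock.finite z k)) :
    0 < k ∧ ∃ u : Fin k → Fin n → ℂ, (∀ j, u j ≠ 0) ∧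
      (∀ h : 0 < k, A *ᵥ u ⟨0, h⟩ = z • (E *ᵥ u ⟨0, h⟩)) ∧
      ∀ (j : ℕ) (h : j + 1 < k), A *ᵥ u ⟨j + 1, h⟩ =
        z • (E *ᵥ u ⟨j + 1, h⟩) + E *ᵥ u ⟨j, Nat.lt_of_succ_lt h⟩ := by
  obtain ⟨hpos, u, w, hu, hE, hA⟩ := h.exists_chain
  have hEw : ∀ j : Fin k, E *ᵥ u j = w j := fun j => (hE j).trans (sum_one_smul w j)
  have hAw : ∀ j : Fin k, A *ᵥ u j = ∑ l, jordanBlock z k l j • (w : Fin k → Fin n → ℂ) l := hA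
  refine ⟨hpos, u, hu, fun h => ?_, fun j h => ?_⟩
  · exact (hAw _).trans ((sum_jordanBlock_zero z h w).trans (congrArg (z • ·) (hEw _).symm))
  · exact (hAw _).trans ((sum_jordanBlock_succ z h w).trans
      (congrArg₂ (fun x y => z • x + y) (hEw _).symm (hEw _).symm))

theorem HasKroneckerBlock.exists_infinite_chain {k : ℕ}
    (h : HasKroneckerBlock E A (KroneckerBlock.infinite k)) :
    ∃ u : Fin k → Fin n → ℂ, (∀ j, u j ≠ 0) ∧ (∀ h : 0 < k, E *ᵥ u ⟨0, h⟩ = 0) ∧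
      ∀ (j : ℕ) (h : j + 1 < k), E *ᵥ u ⟨j + 1, h⟩ = A *ᵥ u ⟨j, Nat.lt_of_succ_lt h⟩ := by
  obtain ⟨-, u, w, hu, hE, hA⟩ := h.exists_chain
  have hAw : ∀ j : Fin k, A *ᵥ u j = w j := fun j => (hA j).trans (sum_one_smul w j)
  have hEw : ∀ j : Fin k, E *ᵥ u j = ∑ l, jordanBlock 0 k l j • (w : Fin k → Fin n → ℂ) l := hE
  refine ⟨u, hu, fun h => ?_, fun j h => ?_⟩
  · exact (hEw _).trans ((sum_jordanBlock_zero 0 h w).trans (zero_smul _ _))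
  · refine (hEw _).trans ((sum_jordanBlock_succ 0 h w).trans ?_)
    rw [zero_smul, zero_add]
    exact (hAw _).symm

theorem HasKroneckerBlock.pencilEigenvalue {z : ℂ} {k : ℕ}
    (h : HasKroneckerBlock E A (KroneckerBlock.finite z k)) : PencilEigenvalue E A z := by
  obtain ⟨hpos, u, hu, hu0, -⟩ := h.exists_finite_chain
  exact pencilEigenvalue_of_mulVec (hu ⟨0, hpos⟩) (hu0 hpos)

theorem isDHForm_isUnit_of_kronecker (hreg : PencilRegular E A)
    (h1 : ∀ z : ℂ, PencilEigenvalue E A z → z.re ≤ 0)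
    (h2 : ∀ (z : ℂ) (k : ℕ), z.re = 0 →
      HasKroneckerBlock E A (KroneckerBlock.finite z k) → k = 1)
    (h3 : ∀ k : ℕ, HasKroneckerBlock E A (KroneckerBlock.infinite k) → k ≤ 2) :
    IsDHForm (fun Q => IsUnit Q) E A := by
  obtain ⟨m, b, hb⟩ := hreg.exists_isKroneckerForm
  have hblock : ∀ i, IsEquivDissipative (b i).matE (b i).matA := by
    intro i
    -- The hypotheses cover blocks of every Kronecker form of the pencil, in particular this one, so
    -- uniqueness of the form is not needed.
    have hi : HasKroneckerBlock E A (b i) := ⟨m, b, hb, i, rfl⟩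
    have hpos := hb.1 i
    generalize b i = c at hi hpos
    cases c with
    | finite z k =>
      rcases (h1 z hi.pencilEigenvalue).lt_or_eq with hz | hz
      · exact isEquivDissipative_finite_of_re_neg hz k
      · obtain rfl := h2 z k hz hi
        exact isEquivDissipative_finite_one hz
    | infinite k =>
      have hk := h3 k hi
      change 0 < k at hpos
      obtain rfl | rfl : k = 1 ∨ k = 2 := by omega
      · exact isEquivDissipative_infinite_one
      · exact isEquivDissipative_infinite_two
  obtain ⟨-, e, S, T, hS, hT, hSE, hSA⟩ := hb
  refine isDHForm_of_exists_left (IsEquivDissipative.exists_left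
    (IsEquivDissipative.of_equiv hS hT ?_))
  rw [hSE, hSA]
  exact (IsEquivDissipative.blockDiagonal' hblock).reindex e

theorem kronecker_of_isDHForm_isUnit (hreg : PencilRegular E A)
    (h : IsDHForm (fun Q => IsUnit Q) E A) :
    (∀ z : ℂ, PencilEigenvalue E A z → z.re ≤ 0) ∧
      (∀ (z : ℂ) (k : ℕ), z.re = 0 →
        HasKroneckerBlock E A (KroneckerBlock.finite z k) → k = 1) ∧
      (∀ k : ℕ, HasKroneckerBlock E A (KroneckerBlock.infinite k) → k ≤ 2) := by
  obtain ⟨S, J, R, hS, hE, hJ, hR, hA⟩ := h.exists_left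
  have hJA : ∀ v, (J - R) *ᵥ v = S *ᵥ (A *ᵥ v) := fun v => by rw [← hA, mulVec_mulVec]
  have hSE : ∀ v, (S * E) *ᵥ v = S *ᵥ (E *ᵥ v) := fun v => (mulVec_mulVec v S E).symm
  have hinj := mulVec_injective_of_isUnit hS
  -- A common null vector of `E` and `A` would make `det(zE - A)` vanish for all `z`.
  have hker : ∀ v, (S * E) *ᵥ v = 0 → (J - R) *ᵥ v = 0 → v = 0 := by
    intro v hv1 hv2
    rw [hSE] at hv1
    rw [hJA] at hv2
    have hv1' : E *ᵥ v = 0 := hinj (hv1.trans (mulVec_zero S).symm)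
    have hv2' : A *ᵥ v = 0 := hinj (hv2.trans (mulVec_zero S).symm)
    obtain ⟨z, hz⟩ := hreg
    by_contra hv
    exact hz (pencilEigenvalue_of_mulVec hv (by rw [hv1', hv2', smul_zero]))
  refine ⟨fun z hz => ?_, fun z k hz hk => ?_, fun k hk => ?_⟩
  · obtain ⟨v, hv0, hv⟩ := exists_mulVec_eq_zero_iff.2 hz
    rw [sub_mulVec, smul_mulVec, sub_eq_zero] at hv
    refine re_nonpos_of_eigenvector hE hJ hR hker hv0 ?_
    rw [hJA, hSE, ← hv, mulVec_smul]
  · obtain ⟨hpos, u, hu, hu0, hu1⟩ := hk.exists_finite_chain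
    by_contra hk1
    have hk2 : 0 + 1 < k := by omega
    refine no_imaginary_chain_of_length_two hE hJ hR hker hz (v := u ⟨0, hpos⟩)
      (w := u ⟨0 + 1, hk2⟩) (hu _) ?_ ?_
    · rw [hJA, hSE, hu0, mulVec_smul]
    · rw [hJA, hSE, hSE, hu1, mulVec_add, mulVec_smul]
  · obtain ⟨u, hu, hu0, hu1⟩ := hk.exists_infinite_chain
    by_contra hk3
    have hk0 : 0 < k := by omega
    have hk1 : 0 + 1 < k := by omega
    have hk2 : 1 + 1 < k := by omega
    refine no_infinite_chain_of_length_three hE hJ hR hker (v₀ := u ⟨0, hk0⟩)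
      (v₁ := u ⟨0 + 1, hk1⟩) (v₂ := u ⟨1 + 1, hk2⟩) (hu _) ?_ ?_ ?_
    · rw [hSE, hu0, mulVec_zero]
    · rw [hSE, hJA, hu1]
    · rw [hSE, hJA, hu1]

end Characterization

theorem mainTheorem5 (n : ℕ) (E₀ A₀ : Matrix (Fin n) (Fin n) ℂ)
    (hreg : PencilRegular E₀ A₀) :
    (IsDHForm (fun Q => IsUnit Q) E₀ A₀ ↔
      (∀ z : ℂ, PencilEigenvalue E₀ A₀ z → z.re ≤ 0) ∧
      (∀ (z : ℂ) (k : ℕ), z.re = 0 →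
        HasKroneckerBlock E₀ A₀ (KroneckerBlock.finite z k) → k = 1) ∧
      (∀ k : ℕ, HasKroneckerBlock E₀ A₀ (KroneckerBlock.infinite k) → k ≤ 2)) ∧
    (IsDHForm (fun Q => Q.PosDef) E₀ A₀ ↔
      ∃ T E A : Matrix (Fin n) (Fin n) ℂ, IsUnit T ∧ IsDHForm (fun Q => Q = 1) E A ∧
        E₀ = T⁻¹ * E * T ∧ A₀ = T⁻¹ * A * T) ∧
    (IsDHForm (fun Q => Q.PosDef) E₀ A₀ →
      ∃ (T : Matrix (Fin n) (Fin n) ℂ) (d : Fin n → ℝ), IsUnit T ∧ (∀ i, 0 ≤ d i) ∧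
        T⁻¹ * E₀ * T = Matrix.diagonal fun i => (d i : ℂ)) :=
  ⟨⟨kronecker_of_isDHForm_isUnit hreg,
    fun h => isDHForm_isUnit_of_kronecker hreg h.1 h.2.1 h.2.2⟩,
    isDHForm_posDef_iff, exists_diagonalization_of_isDHForm_posDef⟩
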